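/- Let $G$ be a ring (associative, not necessarily commutative or unital), let $(X,\rho)$ be a nonempty precompact (i.e. totally bounded) metric space, for instance a nonempty compact one, and let $T_1,\dots,T_t$ be pairwise commuting actions of the additive group of $G$ on $X$ by self-mappings: for each $l$, $T_l^{0}=\mathrm{id}_X$ and $T_l^{g+h}=T_l^{g}\circ T_l^{h}$ for all $g,h\in G$, and $T_l^{g}\circ T_m^{h}=T_m^{h}\circ T_l^{g}$ for all $g,h\in G$ and $l\neq m$. (The mappings $T_l^g$ may be continuous, but this is not required.) Let $p_{i,l}\colon G^n\to G$, $i=1,\dots,q$, $l=1,\dots,t$, be polynomials in $n$ variables over $G$ with $p_{i,l}(0,\dots,0)=0$. Here a polynomial over $G$ is a map $G^n\to G$ that is obtained from the coordinate functions and the constants of $G$ by finitely many additions, negations and multiplications (so that constants and variables need not commute; for commutative unital $G$ these are the usual polynomial maps). Then for any $\varepsilon>0$ the set of vectors $g=(g_1,\dots,g_n)\in G^n$ for which there exists $x\in X$ such that for every $i=1,\dots,q$ one has $$\rho\Bigl(\prod_{l=1}^{t}T_l^{\,p_{i,l}(g_1,\dots,g_n)}x,\;x\Bigr)<\varepsilon$$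 is an IP$^*$-set in $(G^n,+)$. That is, for every sequence $(u_j)_{j\in\mathbb N}$ in $G^n$ it contains an element of the form $\sum_{j\in\gamma}u_j$ with $\gamma\subset\mathbb N$ finite and nonempty. -/

import Mathlib

/-- The IP-set generated by a sequence `u` in a commutative semigroup: all sums of finitely many
(at least one) terms of `u` with distinct indices. -/
def ipSet {S : Type*} [AddCommMonoid S] (u : ℕ → S) : Set S :=
  {s | ∃ γ : Finset ℕ, γ.Nonempty ∧ s = ∑ j ∈ γ, u j}

/-- An IP*-set: a set that meets every IP-set. -/
def IsIPStar {S : Type*} [AddCommMonoid S] (E : Set S) : Prop :=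
  ∀ u : ℕ → S, (E ∩ ipSet u).Nonempty

/-- `IsPolynomialMap f`: the map `f : G ^ n → G` is given by a polynomial in `n` variables over the
(not necessarily commutative, not necessarily unital) ring `G`, i.e. it is a sum of monomials, each
of them plus or minus a finite product of variables and of constants of `G`, in any order.  This
includes all polynomials in noncommuting variables with coefficients written on the left and, if
`G` is commutative, it gives exactly the usual polynomial maps. -/
inductive IsPolynomialMap {G : Type*} [NonUnitalRing G] {n : ℕ} : ((Fin n → G) → G) → Prop
  | const (c : G) : IsPolynomialMap (fun _ => c)
  | coord (m : Fin n) : IsPolynomialMap (fun g => g m)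
  | add {f₁ f₂ : (Fin n → G) → G} :
      IsPolynomialMap f₁ → IsPolynomialMap f₂ → IsPolynomialMap (fun g => f₁ g + f₂ g)
  | neg {f : (Fin n → G) → G} : IsPolynomialMap f → IsPolynomialMap (fun g => -f g)
  | mul {f₁ f₂ : (Fin n → G) → G} :
      IsPolynomialMap f₁ → IsPolynomialMap f₂ → IsPolynomialMap (fun g => f₁ g * f₂ g)

/-- Given actions `T 0, …, T (t - 1)` of an additive group `G` on `X`, the composition
`T 0 ^ a 0 ∘ ⋯ ∘ T (t - 1) ^ a (t - 1)`, where `a : Fin t → G`. Here an action of `G` is a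
homomorphism from `G`, written multiplicatively, to the monoid of self-maps of `X`. -/
def jointAction {G X : Type*} [AddGroup G] {t : ℕ}
    (T : Fin t → Multiplicative G →* Function.End X) (a : Fin t → G) : Function.End X :=
  (List.ofFn fun l => T l (Multiplicative.ofAdd (a l))).prod

/-! Fix `x₀` and colour `a : Fin t → G` by a point of a finite `ε / 2`-net near `jointAction T a
x₀`. Since the actions commute, `jointAction` is additive in `a`, so a monochromatic configuration
`a`, `a + F i d` with `d` a finite sum of the `u j` makes `jointAction T a x₀` the required point.
Such configurations come from a polynomial van der Waerden theorem,
`polyRecurrent_of_mem_zeroPolyMaps`, where "polynomial" only means that iterated differences vanish;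
thus noncommutativity of `G` plays no role. Its proof is PET induction: colour focusing
(`exists_focused`) reduces a family `A` to the family of maps `f (x + v) - f v - p x`, and for `p ∈
A` nonzero of least degree this family has smaller weight. -/

/-! ### Polynomial maps between abelian groups, via differences. -/

section PolynomialMaps

variable {V H : Type*} [AddCommGroup V] [AddCommGroup H]

/-- The difference operator `f ↦ (x ↦ f (x + v) - f x)`. -/
def differenceHom (v : V) : (V → H) →+ (V → H) where
  toFun f x := f (x + v) - f x
  map_zero' := by ext; simp
  map_add' f g := by ext; simp only [Pi.add_apply]; abel

/-- The group of maps `V → H` all of whose `d`-fold differences vanish. -/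
def polyMaps (V H : Type*) [AddCommGroup V] [AddCommGroup H] : ℕ → AddSubgroup (V → H)
  | 0 => ⊥
  | d + 1 => ⨅ v, (polyMaps V H d).comap (differenceHom v)

theorem mem_polyMaps_zero {f : V → H} : f ∈ polyMaps V H 0 ↔ f = 0 := by
  simp [polyMaps]

theorem mem_polyMaps_succ {d : ℕ} {f : V → H} :
    f ∈ polyMaps V H (d + 1) ↔ ∀ v, (fun x => f (x + v) - f x) ∈ polyMaps V H d := by
  simp only [polyMaps, AddSubgroup.mem_iInf, AddSubgroup.mem_comap]
  rfl

theorem polyMaps_mono : Monotone (polyMaps V H) := by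
  refine monotone_nat_of_le_succ fun d => ?_
  induction d with
  | zero =>
    intro f hf
    rw [mem_polyMaps_zero] at hf
    subst hf
    exact zero_mem _
  | succ d ih =>
    intro f hf
    rw [mem_polyMaps_succ] at hf ⊢
    exact fun v => ih (hf v)

theorem const_mem_polyMaps (c : H) (d : ℕ) : (fun _ : V => c) ∈ polyMaps V H (d + 1) := by
  rw [mem_polyMaps_succ]
  intro v
  simp only [sub_self]
  exact zero_mem _

/-- Product rule: the difference of `f * g` is `Δf * Δg + f * Δg + Δf * g`, and each term has a
smaller sum of indices. -/
theorem mul_mem_polyMaps {R : Type*} [NonUnitalRing R] (s : ℕ) :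
    ∀ (a b : ℕ) (f g : V → R), a + b = s → f ∈ polyMaps V R a → g ∈ polyMaps V R b →
      (fun x => f x * g x) ∈ polyMaps V R s := by
  induction s using Nat.strong_induction_on with
  | _ s ih =>
    intro a b f g hs hf hg
    rcases a with _ | a
    · rw [mem_polyMaps_zero] at hf
      subst hf
      simp only [Pi.zero_apply, zero_mul]
      exact zero_mem _
    rcases b with _ | b
    · rw [mem_polyMaps_zero] at hg
      subst hg
      simp only [Pi.zero_apply, mul_zero]
      exact zero_mem _
    obtain rfl : a + b + 1 + 1 = s := by omega
    rw [mem_polyMaps_succ]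
    intro v
    have hf' := mem_polyMaps_succ.1 hf v
    have hg' := mem_polyMaps_succ.1 hg v
    have h1 := ih (a + b) (by omega) a b _ _ rfl hf' hg'
    have h2 := ih (a + b + 1) (by omega) (a + 1) b _ _ (by omega) hf hg'
    have h3 := ih (a + b + 1) (by omega) a (b + 1) _ _ (by omega) hf' hg
    convert add_mem (add_mem (polyMaps_mono (Nat.le_succ _) h1) h2) h3 using 1
    ext x
    simp only [Pi.add_apply, sub_mul, mul_sub]
    abel

theorem pi_mem_polyMaps {ι : Type*} {d : ℕ} {f : V → ι → H}
    (hf : ∀ l, (fun x => f x l) ∈ polyMaps V H d) : f ∈ polyMaps V (ι → H) d := by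
  induction d generalizing f with
  | zero =>
    rw [mem_polyMaps_zero]
    ext x l
    exact congrFun (mem_polyMaps_zero.1 (hf l)) x
  | succ d ih =>
    rw [mem_polyMaps_succ]
    exact fun v => ih fun l => mem_polyMaps_succ.1 (hf l) v

theorem IsPolynomialMap.exists_mem_polyMaps {G : Type*} [NonUnitalRing G] {n : ℕ}
    {f : (Fin n → G) → G} (hf : IsPolynomialMap f) :
    ∃ d, f ∈ polyMaps (Fin n → G) G d := by
  induction hf with
  | const c => exact ⟨1, const_mem_polyMaps c 0⟩
  | coord m =>
    refine ⟨2, mem_polyMaps_succ.2 fun v => ?_⟩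
    simp only [Pi.add_apply, add_sub_cancel_left]
    exact const_mem_polyMaps (v m) 0
  | add _ _ h₁ h₂ =>
    obtain ⟨a, ha⟩ := h₁
    obtain ⟨b, hb⟩ := h₂
    exact ⟨max a b, add_mem (polyMaps_mono (le_max_left a b) ha)
      (polyMaps_mono (le_max_right a b) hb)⟩
  | neg _ h =>
    obtain ⟨a, ha⟩ := h
    exact ⟨a, neg_mem ha⟩
  | mul _ _ h₁ h₂ =>
    obtain ⟨a, ha⟩ := h₁
    obtain ⟨b, hb⟩ := h₂
    exact ⟨a + b, mul_mem_polyMaps _ a b _ _ rfl ha hb⟩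

/-- Polynomial maps of degree at most `d` that vanish at `0`. -/
def zeroPolyMaps (V H : Type*) [AddCommGroup V] [AddCommGroup H] (d : ℕ) :
    AddSubgroup (V → H) :=
  polyMaps V H (d + 1) ⊓ (Pi.evalAddMonoidHom (fun _ : V => H) 0).ker

theorem mem_zeroPolyMaps {d : ℕ} {f : V → H} :
    f ∈ zeroPolyMaps V H d ↔ f ∈ polyMaps V H (d + 1) ∧ f 0 = 0 :=
  Iff.rfl

theorem zeroPolyMaps_mono : Monotone (zeroPolyMaps V H) := fun _ _ h _ hf =>
  ⟨polyMaps_mono (Nat.succ_le_succ h) hf.1, hf.2⟩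

theorem mem_zeroPolyMaps_zero {f : V → H} : f ∈ zeroPolyMaps V H 0 ↔ f = 0 := by
  constructor
  · rintro ⟨h1, h2 : f 0 = 0⟩
    ext v
    have := congrFun (mem_polyMaps_zero.1 (mem_polyMaps_succ.1 h1 v)) 0
    simpa [h2] using this
  · rintro rfl
    exact zero_mem _

theorem shift_sub_mem_zeroPolyMaps {d : ℕ} {f : V → H} (hf : f ∈ zeroPolyMaps V H (d + 1))
    (v : V) : (fun x => f (x + v) - f v - f x) ∈ zeroPolyMaps V H d := by
  rw [mem_zeroPolyMaps] at hf ⊢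
  refine ⟨?_, by simp [hf.2]⟩
  convert sub_mem (mem_polyMaps_succ.1 hf.1 v) (const_mem_polyMaps (f v) d) using 1
  ext x
  simp only [Pi.sub_apply]
  abel

theorem shift_mem_zeroPolyMaps {d : ℕ} {f : V → H} (hf : f ∈ zeroPolyMaps V H d)
    (v : V) : (fun x => f (x + v) - f v) ∈ zeroPolyMaps V H d := by
  have h' := shift_sub_mem_zeroPolyMaps (zeroPolyMaps_mono (Nat.le_succ d) hf) v
  convert add_mem h' hf using 1
  ext x
  simp

end PolynomialMaps

/-! ### Recurrence along finite sums and colour focusing. -/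

section Recurrence

open Finset in
/-- For every finite colouring of `H` and every sequence in `V` there is a monochromatic
configuration `{a} ∪ {a + f d | f ∈ A}`, with `d` a finite sum of terms of the sequence, where the
candidates for `a` and `d` form a finite set that depends only on the number of colours. -/
def PolyRecurrent {V H : Type*} [AddCommGroup V] [AddCommGroup H] (A : Set (V → H)) : Prop :=
  ∀ (k : ℕ) (u : ℕ → V), ∃ B : Set H, B.Finite ∧ ∃ N : ℕ, ∀ c : H → Fin k,
    ∃ a ∈ B, ∃ γ ⊆ range N, γ.Nonempty ∧ ∀ f ∈ A, c (a + f (∑ j ∈ γ, u j)) = c a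

variable {V H : Type*} [AddCommGroup V] [AddCommGroup H]

open Finset in
theorem PolyRecurrent.exists_of_finite {A : Set (V → H)} (hA : PolyRecurrent A)
    (κ : Type*) [Finite κ] (u : ℕ → V) : ∃ B : Set H, B.Finite ∧ ∃ N : ℕ, ∀ c : H → κ,
    ∃ a ∈ B, ∃ γ ⊆ range N, γ.Nonempty ∧ ∀ f ∈ A, c (a + f (∑ j ∈ γ, u j)) = c a := by
  obtain ⟨k, ⟨e⟩⟩ := Finite.exists_equiv_fin κ
  obtain ⟨B, hB, N, h⟩ := hA k u
  refine ⟨B, hB, N, fun c => ?_⟩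
  obtain ⟨a, ha, γ, hγ, hne, hf⟩ := h (e ∘ c)
  exact ⟨a, ha, γ, hγ, hne, fun f hfA => e.injective (hf f hfA)⟩

theorem finite_partialSums (u : ℕ → V) (N : ℕ) :
    ((fun γ : Finset ℕ => ∑ j ∈ γ, u j) '' {γ | γ ⊆ Finset.range N}).Finite := by
  refine Set.Finite.image _ ((Finset.finite_toSet (Finset.range N).powerset).subset ?_)
  exact fun γ hγ => Finset.mem_coe.2 (Finset.mem_powerset.2 hγ)

theorem subset_range_add_and_sum (u : ℕ → V) {N N' : ℕ} {γ γ' : Finset ℕ}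
    (hγ : γ ⊆ Finset.range N) (hγ' : γ' ⊆ Finset.range N') (hne : γ'.Nonempty) :
    ∃ δ ⊆ Finset.range (N + N'), δ.Nonempty ∧
      ∑ j ∈ δ, u j = ∑ j ∈ γ, u j + ∑ j ∈ γ', u (N + j) := by
  classical
  refine ⟨γ ∪ γ'.map (addLeftEmbedding N), ?_, ?_, ?_⟩
  · intro j hj
    rw [Finset.mem_union, Finset.mem_map] at hj
    rw [Finset.mem_range]
    rcases hj with hj | ⟨i, hi, rfl⟩
    · have := Finset.mem_range.1 (hγ hj)
      omega
    · have := Finset.mem_range.1 (hγ' hi)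
      simp only [addLeftEmbedding_apply]
      omega
  · exact (hne.map).mono Finset.subset_union_right
  · rw [Finset.sum_union, Finset.sum_map]
    · rfl
    · rw [Finset.disjoint_left]
      intro j hj hj'
      obtain ⟨i, -, rfl⟩ := Finset.mem_map.1 hj'
      have := Finset.mem_range.1 (hγ hj)
      simp only [addLeftEmbedding_apply] at this
      omega

/-- Colour focusing: either there is a monochromatic configuration, or there are `r` configurations
`{a + f d | f ∈ A}` of distinct colours with a common base point `a`. -/
theorem exists_focused {A : Set (V → H)} (hA : A.Finite) (h0 : ∀ f ∈ A, f 0 = 0) (p : V → H)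
    (h : ∀ D : Set V, D.Finite → D.Nonempty →
      PolyRecurrent (Set.image2 (fun f v x => f (x + v) - f v - p x) A D))
    (k : ℕ) (u : ℕ → V) (r : ℕ) :
    ∃ B : Set H, B.Finite ∧ ∃ N : ℕ, ∀ c : H → Fin k,
      (∃ a ∈ B, ∃ γ ⊆ Finset.range N, γ.Nonempty ∧ ∀ f ∈ A, c (a + f (∑ j ∈ γ, u j)) = c a) ∨
      ∃ a ∈ B, ∃ C : Finset (Fin k), C.card = r ∧ ∀ i ∈ C, ∃ γ ⊆ Finset.range N, γ.Nonempty ∧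
        ∀ f ∈ A, c (a + f (∑ j ∈ γ, u j)) = i := by
  induction r with
  | zero => exact ⟨{0}, Set.finite_singleton 0, 0, fun c => Or.inr ⟨0, rfl, ∅, rfl, by simp⟩⟩
  | succ r ih =>
    obtain ⟨B, hB, N, hr⟩ := ih
    set D : Set V := (fun γ : Finset ℕ => ∑ j ∈ γ, u j) '' {γ | γ ⊆ Finset.range N}
    have hDfin : D.Finite := finite_partialSums u N
    have h0D : (0 : V) ∈ D := ⟨∅, by simp, by simp⟩
    -- All points whose colours the first `N` terms can involve. Below, `y` is coloured by the whole
    -- pattern of `c` on `y + E`, and the tail of `u` keeps the index sets disjoint.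
    set E : Set H := Set.image2 (fun b y => b + y) B
      (Set.image2 (fun (f : V → H) v => f v) A D) ∪ B
    have hEfin : E.Finite := (hB.image2 _ (hA.image2 _ hDfin)).union hB
    have : Finite E := hEfin
    obtain ⟨B', hB', N', h'⟩ :=
      (h D hDfin ⟨0, h0D⟩).exists_of_finite (E → Fin k) (fun j => u (N + j))
    set F : Set H := Set.image2 (fun b y => b + y) B' B
    have hFfin : F.Finite := hB'.image2 _ hB
    refine ⟨F ∪ Set.image2 (fun y v => y - p v) F
      ((fun γ : Finset ℕ => ∑ j ∈ γ, u (N + j)) '' {γ | γ ⊆ Finset.range N'}),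
      hFfin.union (hFfin.image2 _ (finite_partialSums (fun j => u (N + j)) N')), N + N',
      fun c => ?_⟩
    obtain ⟨b, hb, γ', hγ', hne', hcol⟩ := h' (fun y e => c (y + e))
    set x : V := ∑ j ∈ γ', u (N + j) with hx
    have hrange : Finset.range N ⊆ Finset.range (N + N') :=
      Finset.range_subset_range.2 (Nat.le_add_right N N')
    have key : ∀ f ∈ A, ∀ v ∈ D, ∀ e ∈ E,
        c (b + (f (x + v) - f v - p x) + e) = c (b + e) := fun f hf v hv e he =>
      congrFun (hcol _ (Set.mem_image2_of_mem hf hv)) ⟨e, he⟩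
    rcases hr (fun y => c (b + y)) with ⟨a, ha, γ, hγ, hne, hm⟩ | ⟨a, ha, C, hC, hfoc⟩
    · refine Or.inl ⟨b + a, Or.inl (Set.mem_image2_of_mem hb ha), γ, hγ.trans hrange, hne, ?_⟩
      intro f hf
      rw [add_assoc]
      exact hm f hf
    · by_cases hca : c (b + a) ∈ C
      · obtain ⟨γ, hγ, hne, hm⟩ := hfoc _ hca
        refine Or.inl ⟨b + a, Or.inl (Set.mem_image2_of_mem hb ha), γ, hγ.trans hrange, hne, ?_⟩
        intro f hf
        rw [add_assoc]
        exact hm f hf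
      -- With base `b + a - p x`, the step `x + v` leads to `b + (f (x + v) - f v - p x) + (a + f
      -- v)`, coloured like `b + (a + f v)`. The old steps `v` keep their colours; `v = 0` gives the
      -- new colour `c (b + a)`.
      · refine Or.inr ⟨b + a - p x, Or.inr (Set.mem_image2_of_mem
          (Set.mem_image2_of_mem hb ha) ⟨γ', hγ', rfl⟩), Finset.cons _ C hca,
          by rw [Finset.card_cons, hC], ?_⟩
        intro i hi
        rcases Finset.mem_cons.1 hi with rfl | hi
        · obtain ⟨δ, hδ, hδne, hsum⟩ :=
            subset_range_add_and_sum u (Finset.empty_subset (Finset.range N)) hγ' hne'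
          refine ⟨δ, hδ, hδne, fun f hf => ?_⟩
          rw [hsum, Finset.sum_empty, zero_add, ← hx, ← key f hf 0 h0D a (Or.inr ha), h0 f hf,
            add_zero]
          congr 1
          abel
        · obtain ⟨γ, hγ, hne, hm⟩ := hfoc _ hi
          obtain ⟨δ, hδ, hδne, hsum⟩ := subset_range_add_and_sum u hγ hγ' hne'
          refine ⟨δ, hδ, hδne, fun f hf => ?_⟩
          have hv : ∑ j ∈ γ, u j ∈ D := ⟨γ, hγ, rfl⟩
          rw [hsum, ← hx, ← hm f hf, ← key f hf _ hv (a + f (∑ j ∈ γ, u j))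
            (Or.inl (Set.mem_image2_of_mem ha (Set.mem_image2_of_mem hf hv))),
            add_comm x]
          congr 1
          abel

/-- Focusing on `k + 1` distinct colours is impossible with only `k` available. -/
theorem PolyRecurrent.of_shifts {A : Set (V → H)} (hA : A.Finite) (h0 : ∀ f ∈ A, f 0 = 0)
    (p : V → H) (h : ∀ D : Set V, D.Finite → D.Nonempty →
      PolyRecurrent (Set.image2 (fun f v x => f (x + v) - f v - p x) A D)) :
    PolyRecurrent A := by
  intro k u
  obtain ⟨B, hB, N, hr⟩ := exists_focused hA h0 p h k u (k + 1)
  refine ⟨B, hB, N, fun c => (hr c).resolve_right ?_⟩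
  rintro ⟨-, -, C, hC, -⟩
  have := C.card_le_univ
  rw [hC, Fintype.card_fin] at this
  omega

/-! ### The weight of a family and PET induction. -/

/-- The classes, modulo maps of degree at most `d`, of the members of `A` of degree exactly
`d + 1`. -/
def leadingClasses (A : Set (V → H)) (d : ℕ) : Set ((V → H) ⧸ zeroPolyMaps V H d) :=
  QuotientAddGroup.mk '' {f ∈ A | f ∈ zeroPolyMaps V H (d + 1) ∧ f ∉ zeroPolyMaps V H d}

theorem leadingClasses_finite {A : Set (V → H)} (hA : A.Finite) (d : ℕ) :
    (leadingClasses A d).Finite :=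
  (hA.subset (Set.sep_subset _ _)).image _

theorem leadingClasses_diff_zero (A : Set (V → H)) (d : ℕ) :
    leadingClasses (A \ {0}) d = leadingClasses A d := by
  unfold leadingClasses
  congr 1
  ext f
  constructor
  · rintro ⟨h1, h2⟩
    exact ⟨h1.1, h2⟩
  · rintro ⟨h1, h2⟩
    refine ⟨⟨h1, ?_⟩, h2⟩
    rintro rfl
    exact h2.2 (zero_mem _)

/-- Shifting changes `f` only by terms of lower degree, so the degree bound on `f` descends from `D`
to `d` one step at a time. -/
theorem mem_zeroPolyMaps_of_shift_sub {D d : ℕ} {f p : V → H} (hf : f ∈ zeroPolyMaps V H D)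
    (hp : p ∈ zeroPolyMaps V H d) (v : V)
    (h : (fun x => f (x + v) - f v - p x) ∈ zeroPolyMaps V H d) : f ∈ zeroPolyMaps V H d := by
  induction D with
  | zero =>
    rw [mem_zeroPolyMaps_zero] at hf
    subst hf
    exact zero_mem _
  | succ D ih =>
    by_cases hle : D + 1 ≤ d
    · exact zeroPolyMaps_mono hle hf
    refine ih ?_
    have hs := shift_sub_mem_zeroPolyMaps hf v
    have hle' : d ≤ D := by omega
    convert sub_mem (add_mem (zeroPolyMaps_mono hle' h) (zeroPolyMaps_mono hle' hp)) hs using 1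
    ext x
    simp

theorem leadingClasses_image2_eq {A : Set (V → H)} {D : ℕ} (hA : ∀ f ∈ A, f ∈ zeroPolyMaps V H D)
    {d : ℕ} {p : V → H} (hp : p ∈ zeroPolyMaps V H d) {S : Set V} (hS : S.Nonempty) :
    leadingClasses (Set.image2 (fun f v x => f (x + v) - f v - p x) A S) d =
      leadingClasses A d := by
  have hp' := zeroPolyMaps_mono (Nat.le_succ d) hp
  have hmk : ∀ f ∈ zeroPolyMaps V H (d + 1), ∀ v,
      (QuotientAddGroup.mk (fun x => f (x + v) - f v - p x) : (V → H) ⧸ zeroPolyMaps V H d) =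
        QuotientAddGroup.mk f := by
    intro f hf v
    rw [QuotientAddGroup.eq]
    convert sub_mem hp (shift_sub_mem_zeroPolyMaps hf v) using 1
    ext x
    simp only [Pi.add_apply, Pi.neg_apply, Pi.sub_apply]
    abel
  have hmem : ∀ f ∈ zeroPolyMaps V H D, ∀ v, ∀ e, p ∈ zeroPolyMaps V H e →
      ((fun x => f (x + v) - f v - p x) ∈ zeroPolyMaps V H e ↔ f ∈ zeroPolyMaps V H e) :=
    fun f hf v e hpe => ⟨mem_zeroPolyMaps_of_shift_sub hf hpe v,
      fun h => sub_mem (shift_mem_zeroPolyMaps h v) hpe⟩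
  ext y
  constructor
  · rintro ⟨-, ⟨⟨f, hf, v, -, rfl⟩, h1, h2⟩, rfl⟩
    dsimp only at h1 h2 ⊢
    rw [hmem f (hA f hf) v _ hp'] at h1
    rw [hmem f (hA f hf) v _ hp] at h2
    exact ⟨f, ⟨hf, h1, h2⟩, (hmk f h1 v).symm⟩
  · rintro ⟨f, ⟨hf, h1, h2⟩, rfl⟩
    obtain ⟨v, hv⟩ := hS
    refine ⟨_, ⟨Set.mem_image2_of_mem hf hv, ?_, ?_⟩, hmk f h1 v⟩
    · exact (hmem f (hA f hf) v _ hp').2 h1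
    · exact fun h => h2 ((hmem f (hA f hf) v _ hp).1 h)

/-- In the least degree each class is translated by minus the class of `p`; the class of `p` itself
falls to lower degree and is lost. -/
theorem ncard_leadingClasses_image2_lt {A : Set (V → H)} (hfin : A.Finite) {D : ℕ}
    (hA : ∀ f ∈ A, f ∈ zeroPolyMaps V H D) {d : ℕ} (hmin : ∀ f ∈ A, f ∉ zeroPolyMaps V H d)
    {p : V → H} (hpA : p ∈ A) (hp : p ∈ zeroPolyMaps V H (d + 1)) (S : Set V) :
    (leadingClasses (Set.image2 (fun f v x => f (x + v) - f v - p x) A S) d).ncard <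
      (leadingClasses A d).ncard := by
  have hpmem : (QuotientAddGroup.mk p : (V → H) ⧸ zeroPolyMaps V H d) ∈ leadingClasses A d :=
    ⟨p, ⟨hpA, hp, hmin p hpA⟩, rfl⟩
  have hLfin := leadingClasses_finite hfin d
  have hsub : leadingClasses (Set.image2 (fun f v x => f (x + v) - f v - p x) A S) d ⊆
      (fun y => y - QuotientAddGroup.mk p) ''
        (leadingClasses A d \ {(QuotientAddGroup.mk p : (V → H) ⧸ zeroPolyMaps V H d)}) := by
    rintro _ ⟨-, ⟨⟨f, hf, v, -, rfl⟩, h1, h2⟩, rfl⟩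
    dsimp only at h1 h2 ⊢
    have hf1 := mem_zeroPolyMaps_of_shift_sub (hA f hf) hp v h1
    have hs := shift_sub_mem_zeroPolyMaps hf1 v
    refine ⟨QuotientAddGroup.mk f, ⟨⟨f, ⟨hf, hf1, hmin f hf⟩, rfl⟩, ?_⟩, ?_⟩
    · intro heq
      rw [Set.mem_singleton_iff, QuotientAddGroup.eq] at heq
      apply h2
      convert sub_mem hs heq using 1
      ext x
      simp only [Pi.add_apply, Pi.neg_apply, Pi.sub_apply]
      abel
    · dsimp only
      rw [← QuotientAddGroup.mk_sub, QuotientAddGroup.eq]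
      convert hs using 1
      ext x
      simp only [Pi.add_apply, Pi.neg_apply, Pi.sub_apply]
      abel
  calc _ ≤ _ := Set.ncard_le_ncard hsub ((hLfin.subset Set.sdiff_subset).image _)
    _ ≤ _ := Set.ncard_image_le (hLfin.subset Set.sdiff_subset)
    _ < _ := Set.ncard_sdiff_singleton_lt_of_mem hpmem hLfin

theorem PolyRecurrent.of_diff_zero {A : Set (V → H)} (h : PolyRecurrent (A \ {0})) :
    PolyRecurrent A := by
  intro k u
  obtain ⟨B, hB, N, h⟩ := h k u
  refine ⟨B, hB, N, fun c => ?_⟩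
  obtain ⟨a, ha, γ, hγ, hne, hm⟩ := h c
  refine ⟨a, ha, γ, hγ, hne, fun f hf => ?_⟩
  by_cases hf0 : f = 0
  · simp [hf0]
  · exact hm f ⟨hf, hf0⟩

theorem polyRecurrent_empty : PolyRecurrent (∅ : Set (V → H)) := fun _ _ =>
  ⟨{0}, Set.finite_singleton 0, 1, fun _ => ⟨0, rfl, Finset.range 1, subset_rfl, by simp, by simp⟩⟩

/-- The polynomial van der Waerden theorem for abelian groups, along finite sums. -/
theorem polyRecurrent_of_mem_zeroPolyMaps (D : ℕ) {A : Set (V → H)} (hfin : A.Finite)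
    (hA : ∀ f ∈ A, f ∈ zeroPolyMaps V H D) : PolyRecurrent A := by
  -- The order `>` on indices makes the highest degree most significant, so new classes below the
  -- degree of `p` do no harm.
  have wf : WellFounded (Pi.Lex (· > · : Fin D → Fin D → Prop)
      (fun {_} => (· < · : ℕ → ℕ → Prop))) :=
    Pi.Lex.wellFounded _ fun _ => wellFounded_lt
  induction hw : (fun d : Fin D => (leadingClasses A d).ncard) using wf.induction
    generalizing A with
  | _ w ih =>
    subst hw
    apply PolyRecurrent.of_diff_zero
    rcases (A \ {0}).eq_empty_or_nonempty with hemp | ⟨g, hg⟩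
    · rw [hemp]
      exact polyRecurrent_empty
    classical
    have hex : ∃ m, ∃ f ∈ A \ {0}, f ∈ zeroPolyMaps V H m := ⟨D, g, hg, hA g hg.1⟩
    obtain ⟨p, hpA, hp⟩ := Nat.find_spec hex
    have hmin := fun m => Nat.find_min hex (m := m)
    have hleD : Nat.find hex ≤ D := Nat.find_min' hex ⟨g, hg, hA g hg.1⟩
    generalize Nat.find hex = m at hp hmin hleD
    rcases m with _ | d
    · exact absurd (mem_zeroPolyMaps_zero.1 hp) hpA.2
    have hmin' : ∀ f ∈ A \ {0}, f ∉ zeroPolyMaps V H d :=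
      fun f hf h => hmin d (Nat.lt_succ_self d) ⟨f, hf, h⟩
    have hfin' : (A \ {0}).Finite := hfin.subset Set.sdiff_subset
    have hA' : ∀ f ∈ A \ {0}, f ∈ zeroPolyMaps V H D := fun f hf => hA f hf.1
    refine PolyRecurrent.of_shifts hfin' (fun f hf => (hA' f hf).2) p fun S hS hSne => ?_
    refine ih _ ⟨⟨d, hleD⟩, fun j hj => ?_, ?_⟩ (hfin'.image2 _ hS) ?_ rfl
    · dsimp only
      rw [leadingClasses_image2_eq hA' (zeroPolyMaps_mono (show d + 1 ≤ j from hj) hp) hSne,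
        leadingClasses_diff_zero]
    · dsimp only
      rw [← leadingClasses_diff_zero A]
      exact ncard_leadingClasses_image2_lt hfin' hA' hmin' hpA hp S
    · rintro _ ⟨f, hf, v, -, rfl⟩
      exact sub_mem (shift_mem_zeroPolyMaps (hA' f hf) v) (hA' p hpA)

end Recurrence

/-! ### Commuting actions and the recurrence theorem. -/

theorem jointAction_succ {G X : Type*} [AddGroup G] {t : ℕ}
    (T : Fin (t + 1) → Multiplicative G →* Function.End X) (a : Fin (t + 1) → G) :
    jointAction T a = T 0 (Multiplicative.ofAdd (a 0)) *
      jointAction (fun l => T l.succ) (fun l => a l.succ) := by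
  simp [jointAction, List.ofFn_succ]

theorem jointAction_add {G X : Type*} [AddCommGroup G] {t : ℕ}
    (T : Fin t → Multiplicative G →* Function.End X)
    (hT : ∀ l m : Fin t, l ≠ m → ∀ a b : Multiplicative G, Commute (T l a) (T m b))
    (a b : Fin t → G) : jointAction T (a + b) = jointAction T a * jointAction T b := by
  induction t with
  | zero => simp [jointAction]
  | succ t ih =>
    have hcomm : Commute (T 0 (Multiplicative.ofAdd (b 0)))
        (jointAction (fun l => T l.succ) (fun l => a l.succ)) := by
      refine Commute.list_prod_right _ _ fun y hy => ?_
      obtain ⟨l, rfl⟩ := (List.mem_ofFn' _ _).1 hy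
      exact hT _ _ (Fin.succ_ne_zero l).symm _ _
    have hadd := ih (fun l => T l.succ)
      (fun l m hlm => hT _ _ fun h => hlm (Fin.succ_injective _ h))
      (fun l => a l.succ) (fun l => b l.succ)
    rw [jointAction_succ, jointAction_succ T a, jointAction_succ T b, Pi.add_apply, ofAdd_add,
      map_mul]
    simp only [Pi.add_apply]
    change _ * jointAction _ ((fun l : Fin t => a l.succ) + fun l => b l.succ) = _
    rw [hadd, mul_assoc, mul_assoc, ← mul_assoc _ _ (jointAction _ fun l : Fin t => b l.succ),
      hcomm.eq, mul_assoc]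

theorem corollary7p15 {G X : Type*} [NonUnitalRing G] [MetricSpace X] [Nonempty X]
    (hX : TotallyBounded (Set.univ : Set X)) (t q n : ℕ)
    (T : Fin t → Multiplicative G →* Function.End X)
    (hT : ∀ l m : Fin t, l ≠ m → ∀ (a b : Multiplicative G) (x : X),
      T l a (T m b x) = T m b (T l a x))
    (p : Fin q → Fin t → (Fin n → G) → G)
    (hp : ∀ i l, IsPolynomialMap (p i l)) (hp0 : ∀ i l, p i l 0 = 0)
    (ε : ℝ) (hε : 0 < ε) :
    IsIPStar {g : Fin n → G |
      ∃ x : X, ∀ i : Fin q, dist (jointAction T (fun l => p i l g) x) x < ε} := by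
  intro u
  choose d hd using fun i l => (hp i l).exists_mem_polyMaps
  set D : ℕ := ∑ i, ∑ l, d i l
  have hdD : ∀ i l, d i l ≤ D := fun i l =>
    (Finset.single_le_sum (f := fun l => d i l) (fun _ _ => Nat.zero_le _)
      (Finset.mem_univ l)).trans
    (Finset.single_le_sum (f := fun i => ∑ l, d i l) (fun _ _ => Nat.zero_le _)
      (Finset.mem_univ i))
  set F : Fin q → (Fin n → G) → Fin t → G := fun i g l => p i l g
  have hFmem : ∀ f ∈ Set.range F, f ∈ zeroPolyMaps (Fin n → G) (Fin t → G) D := by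
    rintro _ ⟨i, rfl⟩
    exact ⟨pi_mem_polyMaps fun l => polyMaps_mono ((hdD i l).trans (Nat.le_succ D)) (hd i l),
      funext fun l => hp0 i l⟩
  obtain ⟨s, hs, hcover⟩ := Metric.totallyBounded_iff.1 hX (ε / 2) (half_pos hε)
  have hcol : ∀ x : X, ∃ y : s, dist x y < ε / 2 := by
    intro x
    obtain ⟨y, hy, hxy⟩ := Set.mem_iUnion₂.1 (hcover (Set.mem_univ x))
    exact ⟨⟨y, hy⟩, hxy⟩
  choose col hcol using hcol
  have : Finite s := hs
  obtain ⟨x₀⟩ := ‹Nonempty X›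
  obtain ⟨B, -, N, h⟩ := (polyRecurrent_of_mem_zeroPolyMaps D (Set.finite_range F)
    hFmem).exists_of_finite s u
  obtain ⟨a, -, γ, -, hne, hm⟩ := h fun b => col (jointAction T b x₀)
  refine ⟨∑ j ∈ γ, u j, ⟨jointAction T a x₀, fun i => ?_⟩, γ, hne, rfl⟩
  have hi := hm (F i) ⟨i, rfl⟩
  -- The order is swapped so that `F i` acts last, on the point `jointAction T a x₀`.
  rw [add_comm, jointAction_add T (fun l m hlm b b' => funext (hT l m hlm b b'))] at hi
  have h1 := hcol ((jointAction T (F i (∑ j ∈ γ, u j)) * jointAction T a) x₀)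
  have h2 := hcol (jointAction T a x₀)
  rw [show col ((jointAction T (F i (∑ j ∈ γ, u j)) * jointAction T a) x₀) =
    col (jointAction T a x₀) from hi] at h1
  calc dist ((jointAction T (F i (∑ j ∈ γ, u j)) * jointAction T a) x₀) (jointAction T a x₀)
      ≤ _ := dist_triangle_right _ _ _
    _ < ε / 2 + ε / 2 := add_lt_add h1 h2
    _ = ε := add_halves ε
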